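/- For integers $n\ge 4$ and $1\le k<\frac n2$, let $B(n,k)$ be the graph whose vertices are the subsets of $[n]=\{1,\dots,n\}$ of size $k$ or $k+1$, two vertices being adjacent if and only if one is properly contained in the other, and let $L(B(n,k))$ be its line graph. (A graph is vertex-transitive if its automorphism group acts transitively on its vertices. A Cayley graph is a graph isomorphic to the graph with vertex set $G$ and edges $\{g,h\}$ with $g^{-1}h\in\Omega$, for some finite group $G$ and some $\Omega\subseteq G$ such that $1\notin\Omega$ and $x\in\Omega\Rightarrow x^{-1}\in\Omega$.) **Theorem.** Let $k>2$ be an even integer that is not a power of $2$. Then the graph $L(B(2k+1,k))$ is vertex-transitive and is not a Cayley graph. -/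

import Mathlib

/-- The graph `B(n, k)`: the vertices are the `k`-subsets and the `(k+1)`-subsets of an `n`-element
set, and two vertices are adjacent when one is properly contained in the other. -/
def layerGraph (n k : ℕ) : SimpleGraph {s : Finset (Fin n) // s.card = k ∨ s.card = k + 1} where
  Adj v w := v.1 ⊂ w.1 ∨ w.1 ⊂ v.1
  symm := ⟨fun _ _ h => h.symm⟩
  loopless := ⟨fun _ h => h.elim (fun h => h.ne rfl) (fun h => h.ne rfl)⟩

/-- The automorphism group of the graph acts transitively on its vertices. -/
def IsVertexTransitive {V : Type*} (Γ : SimpleGraph V) : Prop :=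
  ∀ u v : V, ∃ φ : Γ ≃g Γ, φ u = v

/-- `Γ` is (isomorphic to) the Cayley graph of a finite group `G` with respect to an inverse-closed
set `Ω` that does not contain the identity; for such `Ω`, distinct `g`, `h` are adjacent in
`SimpleGraph.mulCayley Ω` exactly when `g⁻¹ * h ∈ Ω`. As `G` is in bijection with the vertex set,
it is no restriction to take `G` in the universe of the vertex set. -/
def IsCayleyGraph.{u} {V : Type u} (Γ : SimpleGraph V) : Prop :=
  ∃ (G : Type u) (_ : Group G) (Ω : Set G), Finite G ∧ (∀ x ∈ Ω, x⁻¹ ∈ Ω) ∧ (1 : G) ∉ Ω ∧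
    Nonempty (Γ ≃g SimpleGraph.mulCayley Ω)

/-!
Write `Γ` for the layer graph with `n = 2 k + 1`. An edge of `Γ` is a flag `A ⊂ insert x A` with
`|A| = k`. Permutations of the points act transitively on flags, so the line graph is
vertex-transitive.

Suppose that the line graph were the Cayley graph of a group `G`. Left translations make `G` act
regularly by automorphisms of the line graph, and by Whitney's theorem
(`SimpleGraph.exists_iso_of_lineGraph_iso`) each of them is induced by an automorphism of `Γ`. As
`Γ` is connected, an automorphism either preserves or exchanges the two layers
(`layerGraph_iso_card_iff`), so the elements of `G` that preserve them form a subgroup `S` of index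
at most 2. The order of `G` is the number of edges `(2 k + 1) * centralBinom k`; the 2-adic
valuation of `centralBinom k` is the number of binary digits `1` of `k` by Kummer's theorem, and so
`4` divides `|G|` when `k` is not a power of 2. Hence `|S|` is even and `S` contains an involution.

An automorphism of `Γ` that preserves the layers is induced by a permutation of the points
(`Finset.exists_perm_of_layers`), so the involution in `S` is given by an involution `σ` of the
`2 k + 1` points. It fixes a point `x`, and since `k` is even, `k` of the other points can be chosen
as a union of 2-cycles and pairs of fixed points (`exists_invariant_flag`). The resulting flag is
fixed, which contradicts regularity.
-/

/-! ### Automorphisms of line graphs of triangle-free graphs -/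

namespace SimpleGraph

variable {V : Type*} {G : SimpleGraph V}

/-- In a triangle-free graph, edges that meet two distinct edges at `w` pass through `w`: otherwise
the three edges form a triangle. -/
lemma mem_of_meets_two_edges (tf : ∀ a b c, G.Adj a b → G.Adj a c → ¬ G.Adj b c)
    {e f g : Sym2 V} (he : e ∈ G.edgeSet) (hf : f ∈ G.edgeSet) (hg : g ∈ G.edgeSet) (hef : e ≠ f)
    {w : V} (hwe : w ∈ e) (hwf : w ∈ f) (heg : ∃ u, u ∈ e ∧ u ∈ g) (hfg : ∃ u, u ∈ f ∧ u ∈ g) :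
    w ∈ g := by
  by_contra hw
  obtain ⟨u, hue, hug⟩ := heg
  obtain ⟨u', huf, hug'⟩ := hfg
  have hwu : w ≠ u := by rintro rfl; exact hw hug
  have hwu' : w ≠ u' := by rintro rfl; exact hw hug'
  have h1 := (Sym2.mem_and_mem_iff hwu).1 ⟨hwe, hue⟩
  have h2 := (Sym2.mem_and_mem_iff hwu').1 ⟨hwf, huf⟩
  have huu : u ≠ u' := by rintro rfl; exact hef (h1.trans h2.symm)
  have h3 := (Sym2.mem_and_mem_iff huu).1 ⟨hug, hug'⟩
  subst h1 h2 h3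
  exact tf w u u' he hf hg

/-- When every vertex has two neighbours, a vertex is determined by the edges through it. -/
lemma eq_of_forall_edge_mem (deg : ∀ v, ∃ a b, a ≠ b ∧ G.Adj v a ∧ G.Adj v b) {u v : V}
    (h : ∀ e : G.edgeSet, v ∈ (e : Sym2 V) → u ∈ (e : Sym2 V)) : u = v := by
  obtain ⟨a, b, hab, ha, hb⟩ := deg v
  have h1 := h ⟨s(v, a), ha⟩ (by simp)
  have h2 := h ⟨s(v, b), hb⟩ (by simp)
  simp only [Sym2.mem_iff] at h1 h2
  rcases h1 with h1 | h1
  · exact h1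
  · rcases h2 with h2 | h2
    · exact h2
    · exact absurd (h1.symm.trans h2) hab

/-- An automorphism of the line graph of a triangle-free graph sends stars into stars. -/
lemma exists_forall_mem_lineGraph_iso (tf : ∀ a b c, G.Adj a b → G.Adj a c → ¬ G.Adj b c)
    (deg : ∀ v, ∃ a b, a ≠ b ∧ G.Adj v a ∧ G.Adj v b) (φ : G.lineGraph ≃g G.lineGraph) (v : V) :
    ∃ w, ∀ e : G.edgeSet, v ∈ (e : Sym2 V) → w ∈ (φ e : Sym2 V) := by
  have key : ∀ e f : G.edgeSet, v ∈ (e : Sym2 V) → v ∈ (f : Sym2 V) → e ≠ f →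
      ∃ u, u ∈ (φ e : Sym2 V) ∧ u ∈ (φ f : Sym2 V) := fun e f he hf hne =>
    (lineGraph_adj_iff_exists.1
      (φ.map_adj_iff.2 (lineGraph_adj_iff_exists.2 ⟨hne, v, he, hf⟩))).2
  obtain ⟨a, b, hab, ha, hb⟩ := deg v
  set e : G.edgeSet := ⟨s(v, a), ha⟩
  set f : G.edgeSet := ⟨s(v, b), hb⟩
  have he : v ∈ (e : Sym2 V) := Sym2.mem_mk_left _ _
  have hf : v ∈ (f : Sym2 V) := Sym2.mem_mk_left _ _
  have hne : e ≠ f := by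
    intro h
    have := congrArg Subtype.val h
    simp only [e, f] at this
    exact hab (Sym2.congr_right.1 this)
  obtain ⟨w, hwe, hwf⟩ := key e f he hf hne
  refine ⟨w, fun g hg => ?_⟩
  by_cases hge : e = g
  · rwa [← hge]
  by_cases hgf : f = g
  · rwa [← hgf]
  exact mem_of_meets_two_edges tf (φ e).2 (φ f).2 (φ g).2
    (fun h => hne (φ.injective (Subtype.ext h))) hwe hwf (key e g he hg hge) (key f g hf hg hgf)

/-- **Whitney's theorem** for triangle-free graphs in which every vertex has two neighbours: each
automorphism of the line graph is induced by an automorphism of the graph. -/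
theorem exists_iso_of_lineGraph_iso (tf : ∀ a b c, G.Adj a b → G.Adj a c → ¬ G.Adj b c)
    (deg : ∀ v, ∃ a b, a ≠ b ∧ G.Adj v a ∧ G.Adj v b) (φ : G.lineGraph ≃g G.lineGraph) :
    ∃ ψ : G ≃g G, ∀ e : G.edgeSet, (φ e : Sym2 V) = Sym2.map ψ e := by
  choose p hp using exists_forall_mem_lineGraph_iso tf deg φ
  choose q hq using exists_forall_mem_lineGraph_iso tf deg φ.symm
  have hqp : ∀ v, q (p v) = v := fun v => eq_of_forall_edge_mem deg fun e he => by
    simpa using hq (p v) (φ e) (hp v e he)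
  have hpq : ∀ v, p (q v) = v := fun v => eq_of_forall_edge_mem deg fun e he => by
    simpa using hp (q v) (φ.symm e) (hq v e he)
  have hpe : ∀ a b (h : G.Adj a b), (φ ⟨s(a, b), h⟩ : Sym2 V) = s(p a, p b) := fun a b h =>
    (Sym2.mem_and_mem_iff fun hab => h.ne (by rw [← hqp a, hab, hqp])).1
      ⟨hp a _ (Sym2.mem_mk_left _ _), hp b _ (Sym2.mem_mk_right _ _)⟩
  have hqe : ∀ a b (h : G.Adj a b), (φ.symm ⟨s(a, b), h⟩ : Sym2 V) = s(q a, q b) := fun a b h =>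
    (Sym2.mem_and_mem_iff fun hab => h.ne (by rw [← hpq a, hab, hpq])).1
      ⟨hq a _ (Sym2.mem_mk_left _ _), hq b _ (Sym2.mem_mk_right _ _)⟩
  refine ⟨⟨⟨p, q, hqp, hpq⟩, fun {a b} => ⟨fun h => ?_, fun h => ?_⟩⟩, ?_⟩
  · have h' : G.Adj (p a) (p b) := h
    have := (φ.symm ⟨s(p a, p b), h'⟩).2
    rw [hqe _ _ h', hqp, hqp] at this
    exact this
  · have := (φ ⟨s(a, b), h⟩).2
    rw [hpe _ _ h] at this
    exact this
  · rintro ⟨e, he⟩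
    induction e with
    | _ a b => exact hpe a b he

end SimpleGraph

/-! ### Maps on two consecutive layers of a power set -/

/-- A map on the `k`-subsets and `(k + 1)`-subsets of a finite type that preserves cardinalities and
inclusions and is injective on each layer is induced by a permutation of the points. The permutation
is read off the sets near one `k`-set `A`; agreement then spreads by induction on the number of
points outside `A`: when this number is at least 2, a `(k + 1)`-set is the union of two `k`-subsets
with fewer points outside `A`, and a `k`-set is the intersection of two `(k + 1)`-sets with equally
many points outside `A`. -/
theorem Finset.exists_perm_of_layers {α : Type*} [Fintype α] [DecidableEq α] {k : ℕ}
    (hkn : k < Fintype.card α) (F : Finset α → Finset α)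
    (hc : ∀ s, s.card = k → (F s).card = k) (hc' : ∀ s, s.card = k + 1 → (F s).card = k + 1)
    (hmono : ∀ s t, s.card = k → t.card = k + 1 → s ⊆ t → F s ⊆ F t)
    (hinj : ∀ s t, s.card = k → t.card = k → F s = F t → s = t)
    (hinj' : ∀ s t, s.card = k + 1 → t.card = k + 1 → F s = F t → s = t) :
    ∃ σ : Equiv.Perm α, ∀ s, s.card = k ∨ s.card = k + 1 → F s = s.image σ := by
  obtain ⟨A, -, hA⟩ := Finset.exists_subset_card_eq (s := (univ : Finset α)) (n := k)
    (by simpa using hkn.le)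
  obtain ⟨y₀, hy₀⟩ : ∃ y, y ∉ A := by
    by_contra! h
    have : A = univ := by ext; simp [h]
    rw [this, card_univ] at hA
    omega
  have hins : ∀ y ∉ A, (insert y A).card = k + 1 := fun y hy => by
    rw [card_insert_of_notMem hy, hA]
  have hcc : ∀ a ∈ A, (A.erase a).card + 1 = k := fun a ha => by
    rw [card_erase_add_one ha, hA]
  have hswap : ∀ a ∈ A, ∀ y ∉ A, (insert y (A.erase a)).card = k := fun a ha y hy => by
    rw [card_insert_of_notMem (fun h => hy (mem_of_mem_erase h)), hcc a ha]
  -- `s y` is the point that `F` adds to `F A` on passing from `A` to `A + y`.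
  have hs : ∀ y, ∃ z, y ∉ A → z ∉ F A ∧ F (insert y A) = insert z (F A) := fun y => by
    by_cases hy : y ∈ A
    · exact ⟨y, fun h => absurd hy h⟩
    · obtain ⟨z, hz, h⟩ := exists_eq_insert_iff.2
        ⟨hmono A (insert y A) hA (hins y hy) (subset_insert _ _), by
          rw [hc A hA, hc' _ (hins y hy)]⟩
      exact ⟨z, fun _ => ⟨hz, h.symm⟩⟩
  choose s hs using hs
  have hsinj : ∀ y ∉ A, ∀ y' ∉ A, s y = s y' → y = y' := fun y hy y' hy' h => by
    have := hinj' _ _ (hins y hy) (hins y' hy') (by rw [(hs y hy).2, (hs y' hy').2, h])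
    have hm : y ∈ insert y' A := this ▸ mem_insert_self _ _
    exact (mem_insert.1 hm).resolve_right hy
  -- `t a y` is the point that `F` removes on passing from `A + y` to `A - a + y`.
  have ht : ∀ a y, ∃ b, a ∈ A → y ∉ A →
      b ∈ F A ∧ F (insert y (A.erase a)) = insert (s y) ((F A).erase b) := fun a y => by
    by_cases hay : a ∈ A ∧ y ∉ A
    · obtain ⟨ha, hy⟩ := hay
      obtain ⟨b, hb, h⟩ := exists_eq_insert_iff.2
        ⟨hmono (insert y (A.erase a)) (insert y A) (hswap a ha y hy) (hins y hy)
          (insert_subset_insert _ (erase_subset _ _)), by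
          rw [hc _ (hswap a ha y hy), hc' _ (hins y hy)]⟩
      rw [(hs y hy).2] at h
      have hF : F (insert y (A.erase a)) = (insert (s y) (F A)).erase b := by
        rw [← h, erase_insert hb]
      have hbs : b ≠ s y := by
        rintro rfl
        rw [erase_insert (hs y hy).1] at hF
        have := hinj _ _ (hswap a ha y hy) hA hF
        exact hy (this ▸ mem_insert_self _ _)
      have hbA : b ∈ F A := (mem_insert.1 (h ▸ mem_insert_self b _)).resolve_left hbs
      exact ⟨b, fun _ _ => ⟨hbA, by rw [hF, erase_insert_of_ne hbs.symm]⟩⟩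
    · exact ⟨a, fun h1 h2 => absurd ⟨h1, h2⟩ hay⟩
  choose t ht using ht
  -- `A - a + y` and `A - a + y'` lie in a common `(k + 1)`-set, which would have to contain
  -- `F A`, `s y` and `s y'` if `t a y` and `t a y'` were different.
  have htt : ∀ a ∈ A, ∀ y ∉ A, ∀ y' ∉ A, t a y = t a y' := fun a ha y hy y' hy' => by
    by_contra hne
    have hyy : y ≠ y' := by rintro rfl; exact hne rfl
    have hU : (insert y (insert y' (A.erase a))).card = k + 1 := by
      rw [card_insert_of_notMem, hswap a ha y' hy']
      simp [hyy, hy]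
    have h1 := hmono _ _ (hswap a ha y hy) hU (insert_subset_insert _ (subset_insert _ _))
    have h2 := hmono _ _ (hswap a ha y' hy') hU (subset_insert _ _)
    rw [(ht a y ha hy).2] at h1
    rw [(ht a y' ha hy').2] at h2
    have h3 : insert (s y) (insert (s y') (F A)) ⊆ F (insert y (insert y' (A.erase a))) := by
      intro z hz
      rcases mem_insert.1 hz with rfl | hz
      · exact h1 (mem_insert_self _ _)
      rcases mem_insert.1 hz with rfl | hz
      · exact h2 (mem_insert_self _ _)
      by_cases hzt : z = t a y
      · exact h2 (mem_insert_of_mem (mem_erase.2 ⟨hzt ▸ hne, hz⟩))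
      · exact h1 (mem_insert_of_mem (mem_erase.2 ⟨hzt, hz⟩))
    have h4 := card_le_card h3
    rw [hc' _ hU, card_insert_of_notMem, card_insert_of_notMem (hs y' hy').1, hc A hA] at h4
    · omega
    · rw [mem_insert, not_or]
      exact ⟨fun h => hyy (hsinj y hy y' hy' h), (hs y hy).1⟩
  set f : α → α := fun x => if x ∈ A then t x y₀ else s x with hf
  have hfinj : Function.Injective f := by
    intro x x' hxx
    by_cases hx : x ∈ A <;> by_cases hx' : x' ∈ A <;>
      simp only [hf, hx, hx', if_true, if_false] at hxx
    · have h := hinj _ _ (hswap x hx y₀ hy₀) (hswap x' hx' y₀ hy₀) (by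
        rw [(ht x y₀ hx hy₀).2, (ht x' y₀ hx' hy₀).2, hxx])
      by_contra hne
      have hm : x ∈ insert y₀ (A.erase x') := mem_insert_of_mem (mem_erase.2 ⟨hne, hx⟩)
      rw [← h] at hm
      rcases mem_insert.1 hm with rfl | hm
      · exact hy₀ hx
      · exact notMem_erase _ _ hm
    · exact absurd (hxx ▸ (ht x y₀ hx hy₀).1) (hs x' hx').1
    · exact absurd (hxx ▸ (ht x' y₀ hx' hy₀).1) (hs x hx).1
    · exact hsinj x hx x' hx' hxx
  let σ : Equiv.Perm α := Equiv.ofBijective f (Finite.injective_iff_bijective.1 hfinj)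
  have hσt : ∀ a ∈ A, σ a = t a y₀ := fun a ha => if_pos ha
  have hσs : ∀ y ∉ A, σ y = s y := fun y hy => if_neg hy
  have hFA : F A = A.image σ := by
    refine (eq_of_subset_of_card_le ?_ ?_).symm
    · intro z hz
      obtain ⟨a, ha, rfl⟩ := mem_image.1 hz
      rw [hσt a ha]
      exact (ht a y₀ ha hy₀).1
    · rw [card_image_of_injective _ σ.injective, hc A hA, hA]
  have main : ∀ d, (∀ B : Finset α, B.card = k + 1 → (B \ A).card = d → F B = B.image σ) ∧
      ∀ B : Finset α, B.card = k → (B \ A).card = d → F B = B.image σ := by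
    intro d
    induction d with
    | zero =>
      refine ⟨fun B hB h => ?_, fun B hB h => ?_⟩ <;>
        have hBA : B ⊆ A := sdiff_eq_empty_iff_subset.1 (card_eq_zero.1 h)
      · have := card_le_card hBA
        omega
      · rw [eq_of_subset_of_card_le hBA (by omega), hFA]
    | succ d ih =>
      have upper : ∀ B : Finset α, B.card = k + 1 → (B \ A).card = d + 1 →
          F B = B.image σ := fun B hB h => by
        rcases Nat.eq_zero_or_pos d with rfl | hd
        · obtain ⟨y, hy⟩ := card_eq_one.1 h
          have hyA : y ∉ A := (mem_sdiff.1 (hy ▸ mem_singleton_self y)).2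
          have hBy : B = insert y A := by
            refine eq_of_subset_of_card_le ?_ (by rw [hins y hyA, hB])
            intro z hz
            by_cases hzA : z ∈ A
            · exact mem_insert_of_mem hzA
            · have : z ∈ B \ A := mem_sdiff.2 ⟨hz, hzA⟩
              rw [hy, mem_singleton] at this
              rw [this]; exact mem_insert_self _ _
          rw [hBy, image_insert, (hs y hyA).2, hFA, hσs y hyA]
        · obtain ⟨x, x', hx, hx', hne⟩ := one_lt_card_iff.1 (show 1 < (B \ A).card by omega)
          have hsub : ∀ x ∈ B \ A, (B.erase x).image σ ⊆ F B := fun x hx => by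
            have hxB := (mem_sdiff.1 hx).1
            have hcx : (B.erase x).card = k := by rw [card_erase_of_mem hxB, hB]; rfl
            rw [← ih.2 (B.erase x) hcx (by
              rw [erase_sdiff_comm, card_erase_of_mem hx, h]; rfl)]
            exact hmono _ _ hcx hB (erase_subset _ _)
          refine (eq_of_subset_of_card_le ?_ ?_).symm
          · intro z hz
            obtain ⟨w, hw, rfl⟩ := mem_image.1 hz
            by_cases hwx : w = x
            · exact hsub x' hx' (mem_image_of_mem _ (mem_erase.2 ⟨hwx ▸ hne, hw⟩))
            · exact hsub x hx (mem_image_of_mem _ (mem_erase.2 ⟨hwx, hw⟩))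
          · rw [card_image_of_injective _ σ.injective, hc' B hB, hB]
      refine ⟨upper, fun B hB h => ?_⟩
      have hAB : (A \ B).card = d + 1 := by
        have h1 := card_sdiff_add_card_inter A B
        have h2 := card_sdiff_add_card_inter B A
        rw [inter_comm] at h2
        omega
      rcases Nat.eq_zero_or_pos d with rfl | hd
      · obtain ⟨y, hy⟩ := card_eq_one.1 h
        obtain ⟨a, ha⟩ := card_eq_one.1 hAB
        have hyA : y ∉ A := (mem_sdiff.1 (hy ▸ mem_singleton_self y)).2
        have haA : a ∈ A ∧ a ∉ B := mem_sdiff.1 (ha ▸ mem_singleton_self a)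
        have hBy : B = insert y (A.erase a) := by
          refine eq_of_subset_of_card_le ?_ (by rw [hswap a haA.1 y hyA, hB])
          intro z hz
          by_cases hzA : z ∈ A
          · refine mem_insert_of_mem (mem_erase.2 ⟨?_, hzA⟩)
            rintro rfl
            exact haA.2 hz
          · have : z ∈ B \ A := mem_sdiff.2 ⟨hz, hzA⟩
            rw [hy, mem_singleton] at this
            rw [this]; exact mem_insert_self _ _
        rw [hBy, image_insert, (ht a y haA.1 hyA).2, image_erase σ.injective, hFA, hσs y hyA,
          hσt a haA.1, htt a haA.1 y hyA y₀ hy₀]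
      · obtain ⟨x, x', hx, hx', hne⟩ := one_lt_card_iff.1 (show 1 < (A \ B).card by omega)
        have hsub : ∀ x ∈ A \ B, F B ⊆ (insert x B).image σ := fun x hx => by
          obtain ⟨hxA, hxB⟩ := mem_sdiff.1 hx
          have hcx : (insert x B).card = k + 1 := by rw [card_insert_of_notMem hxB, hB]
          rw [← upper (insert x B) hcx (by rw [insert_sdiff_of_mem _ hxA, h])]
          exact hmono _ _ hB hcx (subset_insert _ _)
        refine eq_of_subset_of_card_le ?_ ?_
        · intro z hz
          obtain ⟨w, hw, hwz⟩ := mem_image.1 (hsub x hx hz)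
          obtain ⟨w', hw', hwz'⟩ := mem_image.1 (hsub x' hx' hz)
          obtain rfl : w = w' := σ.injective (hwz.trans hwz'.symm)
          refine mem_image.2 ⟨w, ?_, hwz⟩
          rcases mem_insert.1 hw with rfl | hw
          · exact (mem_insert.1 hw').resolve_left hne
          · exact hw
        · rw [card_image_of_injective _ σ.injective, hc B hB, hB]
  exact ⟨σ, fun B hB => hB.elim (fun h => (main _).2 B h rfl) (fun h => (main _).1 B h rfl)⟩

/-! ### Central binomial coefficients modulo 4 -/

/-- The 2-adic valuation of `centralBinom k` is the number of binary digits `1` of `k`. -/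
lemma padicValNat_two_centralBinom (k : ℕ) :
    padicValNat 2 k.centralBinom = (Nat.digits 2 k).sum := by
  have h := sub_one_mul_padicValNat_choose_eq_sub_sum_digits' (p := 2) (k := k) (n := k)
  rw [← two_mul, ← Nat.centralBinom_eq_two_mul_choose] at h
  have h2 : (Nat.digits 2 (2 * k)).sum = (Nat.digits 2 k).sum := by
    rcases Nat.eq_zero_or_pos k with rfl | hk
    · rfl
    · rw [Nat.digits_base_mul one_lt_two hk]; simp
  rw [h2] at h
  omega

lemma eq_two_pow_of_sum_digits_eq_one {k : ℕ} (h : (Nat.digits 2 k).sum = 1) : ∃ t, k = 2 ^ t := by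
  induction k using Nat.strong_induction_on with
  | _ k ih =>
    rcases Nat.eq_zero_or_pos k with rfl | hk
    · simp at h
    rw [Nat.digits_def' one_lt_two hk, List.sum_cons] at h
    rcases Nat.mod_two_eq_zero_or_one k with h0 | h1
    · obtain ⟨t, ht⟩ := ih (k / 2) (by omega) (by omega)
      exact ⟨t + 1, by rw [pow_succ]; omega⟩
    · rcases Nat.eq_zero_or_pos (k / 2) with h2 | h2
      · exact ⟨0, by simp; omega⟩
      · have h3 := ih (k / 2)  (by omega)
        have h4 : (Nat.digits 2 (k / 2)).sum = 0 := by omega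
        rw [← padicValNat_two_centralBinom] at h4
        have h5 := Nat.two_dvd_centralBinom_of_one_le h2
        have := one_le_padicValNat_of_dvd (Nat.centralBinom_ne_zero _) h5
        omega

lemma four_dvd_centralBinom {k : ℕ} (hk : 0 < k) (h : ¬ ∃ t, k = 2 ^ t) : 4 ∣ k.centralBinom := by
  have h1 := one_le_padicValNat_of_dvd (Nat.centralBinom_ne_zero _)
    (Nat.two_dvd_centralBinom_of_one_le hk)
  have h2 : padicValNat 2 k.centralBinom ≠ 1 := fun h2 =>
    h (eq_two_pow_of_sum_digits_eq_one (padicValNat_two_centralBinom k ▸ h2))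
  exact (padicValNat_dvd_iff_le (p := 2) (n := 2) (Nat.centralBinom_ne_zero _)).2 (by omega)

/-! ### Invariant sets of an involution -/

/-- An invariant set of an involution contains invariant sets of every even size that fits: add a
2-cycle or two fixed points at a time. -/
lemma exists_invariant_subset_card {α : Type*} [DecidableEq α] {σ : Equiv.Perm α}
    (hσ : ∀ x, σ (σ x) = x) {s : Finset α} (hs : ∀ x ∈ s, σ x ∈ s) (j : ℕ) (hj : 2 * j ≤ s.card) :
    ∃ A ⊆ s, A.card = 2 * j ∧ ∀ x ∈ A, σ x ∈ A := by
  induction j with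
  | zero => exact ⟨∅, by simp⟩
  | succ j ih =>
    obtain ⟨A, hAs, hA, hinv⟩ := ih (by omega)
    have hcard : 1 < (s \ A).card := by
      rw [Finset.card_sdiff_of_subset hAs]; omega
    suffices h : ∃ y z, y ∈ s \ A ∧ z ∈ s \ A ∧ y ≠ z ∧ (σ y = z ∧ σ z = y ∨ σ y = y ∧ σ z = z) by
      obtain ⟨y, z, hy, hz, hne, h⟩ := h
      rw [Finset.mem_sdiff] at hy hz
      refine ⟨insert y (insert z A), ?_, ?_, ?_⟩
      · simp [Finset.insert_subset_iff, hy.1, hz.1, hAs]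
      · rw [Finset.card_insert_of_notMem (by simp [hne, hy.2]),
          Finset.card_insert_of_notMem hz.2, hA]
        ring
      · intro x hx
        simp only [Finset.mem_insert] at hx ⊢
        rcases hx with rfl | rfl | hx
        · rcases h with h | h <;> simp [h.1]
        · rcases h with h | h <;> simp [h.2]
        · exact Or.inr (Or.inr (hinv x hx))
    by_cases hfix : ∃ y ∈ s \ A, σ y ≠ y
    · obtain ⟨y, hy, hyne⟩ := hfix
      have hy' := Finset.mem_sdiff.1 hy
      refine ⟨y, σ y, hy, Finset.mem_sdiff.2 ⟨hs y hy'.1, fun h => hy'.2 ?_⟩, hyne.symm,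
        Or.inl ⟨rfl, hσ y⟩⟩
      simpa [hσ] using hinv _ h
    · push Not at hfix
      obtain ⟨y, z, hy, hz, hne⟩ := Finset.one_lt_card_iff.1 hcard
      exact ⟨y, z, hy, hz, hne, Or.inr ⟨hfix y hy, hfix z hz⟩⟩

/-- An involution on `2 k + 1` points, `k` even, fixes a flag `A ⊂ insert x A` with `A` of
size `k`. -/
lemma exists_invariant_flag {k : ℕ} (hk : Even k) {σ : Equiv.Perm (Fin (2 * k + 1))}
    (hσ : ∀ x, σ (σ x) = x) :
    ∃ (A : Finset (Fin (2 * k + 1))) (x : Fin (2 * k + 1)), A.card = k ∧ x ∉ A ∧ σ x = x ∧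
      A.image σ = A := by
  obtain ⟨x, hx⟩ := Equiv.Perm.exists_fixed_point_of_prime (p := 2) (n := 1) (σ := σ)
    (by simp) (by ext y; simp [pow_two, hσ])
  obtain ⟨j, rfl⟩ := hk
  obtain ⟨A, hAs, hA, hinv⟩ := exists_invariant_subset_card hσ
    (s := Finset.univ.erase x) (by
      intro y hy
      simp only [Finset.mem_erase, Finset.mem_univ, and_true] at hy ⊢
      exact fun h => hy (σ.injective (h.trans hx.symm))) j (by
      rw [Finset.card_erase_of_mem (Finset.mem_univ _), Finset.card_univ, Fintype.card_fin]; omega)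
  refine ⟨A, x, by omega, fun h => by simpa using hAs h, hx, ?_⟩
  refine Finset.eq_of_subset_of_card_le (fun y hy => ?_) ?_
  · obtain ⟨z, hz, rfl⟩ := Finset.mem_image.1 hy
    exact hinv z hz
  · rw [Finset.card_image_of_injective _ σ.injective]

/-! ### The layer graph -/

section LayerGraph

variable {n k : ℕ}

lemma layerGraph_adj_card {v w : {s : Finset (Fin n) // s.card = k ∨ s.card = k + 1}}
    (h : (layerGraph n k).Adj v w) :
    v.1.card = k ∧ w.1.card = k + 1 ∧ v.1 ⊆ w.1 ∨ w.1.card = k ∧ v.1.card = k + 1 ∧ w.1 ⊆ v.1 := by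
  have hv := v.2
  have hw := w.2
  rcases h with h | h
  · have := Finset.card_lt_card h
    exact Or.inl ⟨by omega, by omega, h.subset⟩
  · have := Finset.card_lt_card h
    exact Or.inr ⟨by omega, by omega, h.subset⟩

lemma layerGraph_adj_insert {A : Finset (Fin n)} {x : Fin n} (hA : A.card = k) (hx : x ∉ A) :
    (layerGraph n k).Adj ⟨A, Or.inl hA⟩
      ⟨insert x A, Or.inr (by rw [Finset.card_insert_of_notMem hx, hA])⟩ :=
  Or.inl (Finset.ssubset_insert hx)

/-- The edge of the layer graph that joins `A` to `insert x A`. -/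
def flagEdge {A : Finset (Fin n)} {x : Fin n} (hA : A.card = k) (hx : x ∉ A) :
    (layerGraph n k).edgeSet :=
  ⟨s(⟨A, Or.inl hA⟩, ⟨insert x A, Or.inr (by rw [Finset.card_insert_of_notMem hx, hA])⟩),
    layerGraph_adj_insert hA hx⟩

lemma exists_eq_flagEdge (e : (layerGraph n k).edgeSet) :
    ∃ (A : Finset (Fin n)) (x : Fin n) (hA : A.card = k) (hx : x ∉ A), e = flagEdge hA hx := by
  have key : ∀ v w (h : (layerGraph n k).Adj v w), v.1.card = k → w.1.card = k + 1 → v.1 ⊆ w.1 →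
      ∃ (A : Finset (Fin n)) (x : Fin n) (hA : A.card = k) (hx : x ∉ A),
        (⟨s(v, w), h⟩ : (layerGraph n k).edgeSet) = flagEdge hA hx := by
    rintro ⟨A, hA'⟩ ⟨B, hB'⟩ h hA hB hAB
    obtain ⟨x, hx, rfl⟩ := Finset.exists_eq_insert_iff.2 ⟨hAB, by rw [hA, hB]⟩
    exact ⟨A, x, hA, hx, rfl⟩
  rcases e with ⟨e, he⟩
  induction e with
  | _ v w =>
    rcases layerGraph_adj_card he with ⟨h1, h2, h3⟩ | ⟨h1, h2, h3⟩
    · exact key v w he h1 h2 h3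
    · obtain ⟨A, x, hA, hx, h⟩ := key w v he.symm h1 h2 h3
      exact ⟨A, x, hA, hx, by rw [← h]; exact Subtype.ext Sym2.eq_swap⟩

lemma layerGraph_triangleFree (a b c : {s : Finset (Fin n) // s.card = k ∨ s.card = k + 1})
    (hab : (layerGraph n k).Adj a b) (hac : (layerGraph n k).Adj a c) :
    ¬ (layerGraph n k).Adj b c := fun hbc => by
  have h1 := layerGraph_adj_card hab
  have h2 := layerGraph_adj_card hac
  have h3 := layerGraph_adj_card hbc
  omega

lemma layerGraph_exists_two_adj (hk : 0 < k) (hn : k + 2 ≤ n)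
    (v : {s : Finset (Fin n) // s.card = k ∨ s.card = k + 1}) :
    ∃ a b, a ≠ b ∧ (layerGraph n k).Adj v a ∧ (layerGraph n k).Adj v b := by
  rcases v with ⟨A, hA⟩
  rcases hA with hA | hA
  · have h : 1 < Aᶜ.card := by rw [Finset.card_compl, Fintype.card_fin]; omega
    obtain ⟨x, y, hx, hy, hne⟩ := Finset.one_lt_card_iff.1 h
    rw [Finset.mem_compl] at hx hy
    refine ⟨_, _, fun h => ?_, layerGraph_adj_insert hA hx, layerGraph_adj_insert hA hy⟩
    have hs : insert x A = insert y A := congrArg Subtype.val h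
    have hm : x ∈ insert y A := hs ▸ Finset.mem_insert_self x A
    exact hne ((Finset.mem_insert.1 hm).resolve_right hx)
  · obtain ⟨x, y, hx, hy, hne⟩ := Finset.one_lt_card_iff.1 (show 1 < A.card by omega)
    have hc : ∀ z ∈ A, (A.erase z).card = k := fun z hz => by
      rw [Finset.card_erase_of_mem hz, hA]; rfl
    refine ⟨⟨A.erase x, Or.inl (hc x hx)⟩, ⟨A.erase y, Or.inl (hc y hy)⟩, fun h => ?_,
      Or.inr (Finset.erase_ssubset hx), Or.inr (Finset.erase_ssubset hy)⟩
    have hs : A.erase x = A.erase y := congrArg Subtype.val h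
    have hm : y ∈ A.erase y := hs ▸ Finset.mem_erase.2 ⟨hne.symm, hy⟩
    exact Finset.notMem_erase _ _ hm

lemma layerGraph_preconnected : (layerGraph n k).Preconnected := by
  have low : ∀ d, ∀ (A B : Finset (Fin n)) (hA : A.card = k) (hB : B.card = k),
      (A \ B).card = d → (layerGraph n k).Reachable ⟨A, Or.inl hA⟩ ⟨B, Or.inl hB⟩ := by
    intro d
    induction d with
    | zero =>
      intro A B hA hB h
      obtain rfl : A = B := Finset.eq_of_subset_of_card_le
        (Finset.sdiff_eq_empty_iff_subset.1 (Finset.card_eq_zero.1 h)) (by omega)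
      exact SimpleGraph.Reachable.refl _
    | succ d ih =>
      intro A B hA hB h
      have h1 := Finset.card_sdiff_add_card_inter A B
      have h2 := Finset.card_sdiff_add_card_inter B A
      rw [Finset.inter_comm] at h2
      obtain ⟨x, hx⟩ := Finset.card_pos.1 (show 0 < (A \ B).card by omega)
      obtain ⟨y, hy⟩ := Finset.card_pos.1 (show 0 < (B \ A).card by omega)
      rw [Finset.mem_sdiff] at hx hy
      have hy' : y ∉ A.erase x := fun h => hy.2 (Finset.mem_of_mem_erase h)
      have hC : (insert y (A.erase x)).card = k := by
        rw [Finset.card_insert_of_notMem hy', Finset.card_erase_add_one hx.1, hA]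
      have hxC : x ∉ insert y (A.erase x) := by
        rw [Finset.mem_insert, not_or]
        exact ⟨fun h => hy.2 (h ▸ hx.1), Finset.notMem_erase _ _⟩
      have hins : insert x (insert y (A.erase x)) = insert y A := by
        rw [Finset.insert_comm, Finset.insert_erase hx.1]
      have hU : (insert y A).card = k + 1 := by rw [Finset.card_insert_of_notMem hy.2, hA]
      have e1 : (layerGraph n k).Adj ⟨A, Or.inl hA⟩ ⟨insert y A, Or.inr hU⟩ :=
        layerGraph_adj_insert hA hy.2
      have e2 : (layerGraph n k).Adj ⟨insert y (A.erase x), Or.inl hC⟩ ⟨insert y A, Or.inr hU⟩ :=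
        by
        have := Finset.ssubset_insert hxC
        rw [hins] at this
        exact Or.inl this
      refine e1.reachable.trans (e2.symm.reachable.trans (ih _ _ hC hB ?_))
      rw [Finset.insert_sdiff_of_mem _ hy.1, Finset.erase_sdiff_comm,
        Finset.card_erase_of_mem (Finset.mem_sdiff.2 hx), h]
      rfl
  have toLow : ∀ v : {s : Finset (Fin n) // s.card = k ∨ s.card = k + 1}, ∃ A, ∃ hA : A.card = k,
      (layerGraph n k).Reachable v ⟨A, Or.inl hA⟩ := by
    rintro ⟨B, hB | hB⟩
    · exact ⟨B, hB, SimpleGraph.Reachable.refl _⟩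
    · obtain ⟨x, hx⟩ := Finset.card_pos.1 (show 0 < B.card by omega)
      have hc : (B.erase x).card = k := by rw [Finset.card_erase_of_mem hx, hB]; rfl
      exact ⟨B.erase x, hc, SimpleGraph.Adj.reachable (Or.inr (Finset.erase_ssubset hx))⟩
  intro v w
  obtain ⟨A, hA, h1⟩ := toLow v
  obtain ⟨B, hB, h2⟩ := toLow w
  exact h1.trans ((low _ A B hA hB rfl).trans h2.symm)

/-- By connectedness, an automorphism of the layer graph that keeps one vertex in its layer keeps
every vertex in its layer; otherwise it exchanges the layers. -/
lemma layerGraph_iso_card_iff (ψ : layerGraph n k ≃g layerGraph n k)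
    (v w : {s : Finset (Fin n) // s.card = k ∨ s.card = k + 1}) :
    (ψ v).1.card = v.1.card ↔ (ψ w).1.card = w.1.card := by
  obtain ⟨p⟩ := layerGraph_preconnected v w
  induction p with
  | nil => rfl
  | cons h _ ih =>
    rw [← ih]
    have h1 := layerGraph_adj_card h
    have h2 := layerGraph_adj_card (ψ.map_adj_iff.2 h)
    omega

/-- The layer-preserving automorphisms of the layer graph come from permutations of the points. -/
lemma layerGraph_exists_perm (hn : k < n) (ψ : layerGraph n k ≃g layerGraph n k)
    (hψ : ∀ v, (ψ v).1.card = v.1.card) :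
    ∃ σ : Equiv.Perm (Fin n), ∀ v, (ψ v).1 = v.1.image σ := by
  classical
  let F : Finset (Fin n) → Finset (Fin n) := fun s =>
    if h : s.card = k ∨ s.card = k + 1 then (ψ ⟨s, h⟩).1 else ∅
  have hF : ∀ s (h : s.card = k ∨ s.card = k + 1), F s = (ψ ⟨s, h⟩).1 := fun s h => dif_pos h
  have hinj : ∀ s t, (s.card = k ∨ s.card = k + 1) → (t.card = k ∨ t.card = k + 1) →
      F s = F t → s = t := fun s t hs ht h => by
    rw [hF s hs, hF t ht] at h
    exact congrArg Subtype.val (ψ.injective (Subtype.ext h))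
  obtain ⟨σ, hσ⟩ := Finset.exists_perm_of_layers (k := k) (by simpa using hn) F
    (fun s hs => by rw [hF s (Or.inl hs), hψ, hs])
    (fun s hs => by rw [hF s (Or.inr hs), hψ, hs])
    (fun s t hs ht hst => by
      have h : (layerGraph n k).Adj ⟨s, Or.inl hs⟩ ⟨t, Or.inr ht⟩ :=
        Or.inl (Finset.ssubset_iff_subset_ne.2 ⟨hst, by
          rintro rfl
          exact k.succ_ne_self (ht.symm.trans hs)⟩)
      rw [hF s (Or.inl hs), hF t (Or.inr ht)]
      have h1 := layerGraph_adj_card (ψ.map_adj_iff.2 h)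
      rw [hψ, hψ] at h1
      rcases h1 with h1 | h1
      · exact h1.2.2
      · exact absurd (ht.symm.trans h1.1) k.succ_ne_self)
    (fun s t hs ht => hinj s t (Or.inl hs) (Or.inl ht))
    (fun s t hs ht => hinj s t (Or.inr hs) (Or.inr ht))
  exact ⟨σ, fun v => by rw [← hσ v.1 v.2, hF v.1 v.2]⟩

/-- The automorphism of the layer graph induced by a permutation of the points. -/
def layerGraphPerm (n k : ℕ) (σ : Equiv.Perm (Fin n)) : layerGraph n k ≃g layerGraph n k where
  toFun v := ⟨v.1.image σ, by rw [Finset.card_image_of_injective _ σ.injective]; exact v.2⟩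
  invFun v := ⟨v.1.image σ.symm, by
    rw [Finset.card_image_of_injective _ σ.symm.injective]; exact v.2⟩
  left_inv v := Subtype.ext (by simp [Finset.image_image])
  right_inv v := Subtype.ext (by simp [Finset.image_image])
  map_rel_iff' {v w} := by
    simp only [layerGraph, Equiv.coe_fn_mk, Finset.image_ssubset_image σ.injective]

lemma coe_layerGraphPerm_apply (σ : Equiv.Perm (Fin n))
    (v : {s : Finset (Fin n) // s.card = k ∨ s.card = k + 1}) :
    (layerGraphPerm n k σ v).1 = v.1.image σ := rfl

/-- The symmetric group is transitive on flags. -/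
lemma exists_perm_image_eq {A B : Finset (Fin n)} {x y : Fin n} (h : A.card = B.card) (hx : x ∉ A)
    (hy : y ∉ B) : ∃ σ : Equiv.Perm (Fin n), A.image σ = B ∧ σ x = y := by
  classical
  let e : {z // z ∈ A} ≃ {z // z ∈ B} := Finset.equivOfCardEq h
  refine ⟨e.extendSubtype.trans (Equiv.swap (e.extendSubtype x) y), ?_, by simp⟩
  refine Finset.eq_of_subset_of_card_le (fun z hz => ?_) ?_
  · obtain ⟨w, hw, rfl⟩ := Finset.mem_image.1 hz
    have h1 : e.extendSubtype w ∈ B := e.extendSubtype_mem w hw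
    have h2 : e.extendSubtype x ∉ B := e.extendSubtype_not_mem x hx
    rw [Equiv.trans_apply, Equiv.swap_apply_of_ne_of_ne]
    · exact h1
    · exact fun h => h2 (h ▸ h1)
    · exact fun h => hy (h ▸ h1)
  · rw [Finset.card_image_of_injective _ (Equiv.injective _), h]

lemma isVertexTransitive_lineGraph_layerGraph (n k : ℕ) :
    IsVertexTransitive (layerGraph n k).lineGraph := by
  intro e f
  obtain ⟨A, x, hA, hx, rfl⟩ := exists_eq_flagEdge e
  obtain ⟨B, y, hB, hy, rfl⟩ := exists_eq_flagEdge f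
  obtain ⟨σ, hσ, hσx⟩ := exists_perm_image_eq (hA.trans hB.symm) hx hy
  refine ⟨(layerGraphPerm n k σ).lineGraph, Subtype.ext ?_⟩
  change Sym2.map (layerGraphPerm n k σ) s(_, _) = s(_, _)
  rw [Sym2.map_mk]
  refine congrArg₂ (fun v w => s(v, w)) (Subtype.ext hσ) (Subtype.ext ?_)
  rw [coe_layerGraphPerm_apply, Finset.image_insert, hσ, hσx]

lemma natCard_edgeSet_layerGraph (n k : ℕ) :
    Nat.card (layerGraph n k).edgeSet = n.choose k * (n - k) := by
  let f : (Σ A : {A : Finset (Fin n) // A.card = k}, {x // x ∉ A.1}) → (layerGraph n k).edgeSet :=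
    fun p => flagEdge p.1.2 p.2.2
  have hf : Function.Bijective f := by
    constructor
    · rintro ⟨⟨A, hA⟩, x, hx⟩ ⟨⟨B, hB⟩, y, hy⟩ h
      have h' := Sym2.eq_iff.1 (congrArg Subtype.val h)
      simp only [Subtype.mk.injEq] at h'
      rcases h' with ⟨rfl, h2⟩ | ⟨h1, -⟩
      · have hm : x ∈ insert y A := h2 ▸ Finset.mem_insert_self x A
        obtain rfl := (Finset.mem_insert.1 hm).resolve_right hx
        rfl
      · have := congrArg Finset.card h1
        rw [Finset.card_insert_of_notMem hy, hA, hB] at this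
        exact absurd this.symm k.succ_ne_self
    · intro e
      obtain ⟨A, x, hA, hx, rfl⟩ := exists_eq_flagEdge e
      exact ⟨⟨⟨A, hA⟩, x, hx⟩, rfl⟩
  rw [← Nat.card_congr (Equiv.ofBijective f hf), Nat.card_sigma]
  have h1 : ∀ A : {A : Finset (Fin n) // A.card = k}, Nat.card {x // x ∉ A.1} = n - k := fun A => by
    rw [Nat.card_eq_fintype_card, Fintype.card_subtype_compl, Fintype.card_fin,
      Fintype.card_coe, A.2]
  rw [Finset.sum_congr rfl fun A _ => h1 A]
  simp

end LayerGraph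

/-! ### Regular groups of automorphisms -/

/-- Left multiplication is an automorphism of a Cayley graph. -/
def SimpleGraph.mulCayleyLeftMul {G : Type*} [Group G] (Ω : Set G) (g : G) :
    SimpleGraph.mulCayley Ω ≃g SimpleGraph.mulCayley Ω where
  toEquiv := Equiv.mulLeft g
  map_rel_iff' := by simp

/-- A finite group whose order is divisible by 4 has an involution in each subgroup that contains
the product of any two elements outside it, since the index of such a subgroup is at most 2. -/
lemma Subgroup.exists_mul_self_eq_one_of_four_dvd {G : Type*} [Group G] [Finite G] (S : Subgroup G)
    (hS : ∀ a b, a ∉ S → b ∉ S → a * b ∈ S) (h4 : 4 ∣ Nat.card G) :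
    ∃ g ∈ S, g ≠ 1 ∧ g * g = 1 := by
  have h2 : 2 ∣ Nat.card S := by
    have hi : S.index ∣ 2 := by
      by_cases h : ∃ a, a ∉ S
      · obtain ⟨a, ha⟩ := h
        rw [S.index_eq_two_iff.2 ⟨a, fun b => ?_⟩]
        by_cases hb : b ∈ S
        · exact Or.inr ⟨hb, fun h => ha ((S.mul_mem_cancel_left hb).1 h)⟩
        · exact Or.inl ⟨hS b a hb ha, hb⟩
      · push Not at h
        rw [(S.eq_top_iff').2 h, Subgroup.index_top]
        exact one_dvd 2
    have hm := S.card_mul_index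
    rcases (Nat.dvd_prime Nat.prime_two).1 hi with h | h <;> rw [h] at hm <;> omega
  obtain ⟨g, hg⟩ := exists_prime_orderOf_dvd_card' 2 h2
  refine ⟨g, g.2, fun h => ?_, ?_⟩
  · rw [OneMemClass.coe_eq_one.1 h, orderOf_one] at hg
    omega
  · have := pow_orderOf_eq_one g
    rw [hg, pow_two] at this
    exact congrArg Subtype.val this

/-- If `4` divides the number of edges, `k` is even and positive, then the line graph of the middle
layer graph is not a Cayley graph: the involution found among the layer-preserving elements of a
regular group is induced by an involution of the points, which fixes a flag. -/
theorem not_isCayleyGraph_lineGraph_middleLayer {k : ℕ} (hk : 0 < k) (hke : Even k)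
    (h4 : 4 ∣ Nat.card (layerGraph (2 * k + 1) k).edgeSet) :
    ¬ IsCayleyGraph (layerGraph (2 * k + 1) k).lineGraph := by
  rintro ⟨G, _, Ω, _, -, -, ⟨f⟩⟩
  set Γ := layerGraph (2 * k + 1) k
  -- The elements of `G` whose left translation comes from a layer-preserving automorphism.
  let S : Subgroup G :=
    { carrier := {g | ∃ ψ : Γ ≃g Γ, (∀ v, (ψ v).1.card = v.1.card) ∧
        ∀ e : Γ.edgeSet, (f.symm (g * f e)).1 = Sym2.map ψ e.1}
      one_mem' := ⟨RelIso.refl _, fun v => rfl, fun e => by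
        rw [one_mul, RelIso.symm_apply_apply]; exact (congrFun Sym2.map_id' _).symm⟩
      mul_mem' := by
        rintro a b ⟨ψ, hψ, ha⟩ ⟨χ, hχ, hb⟩
        refine ⟨χ.trans ψ, fun v => by rw [RelIso.trans_apply, hψ, hχ], fun e => ?_⟩
        have := ha (f.symm (b * f e))
        rw [hb, RelIso.apply_symm_apply, ← mul_assoc, Sym2.map_map] at this
        exact this
      inv_mem' := by
        rintro a ⟨ψ, hψ, ha⟩
        refine ⟨ψ.symm, fun v => ?_, fun e => ?_⟩
        · have := hψ (ψ.symm v)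
          rw [RelIso.apply_symm_apply] at this
          exact this.symm
        · have := ha (f.symm (a⁻¹ * f e))
          rw [RelIso.apply_symm_apply, mul_inv_cancel_left, RelIso.symm_apply_apply] at this
          rw [this, Sym2.map_map]
          conv_lhs => rw [← id_eq (f.symm (a⁻¹ * f e)).1, ← Sym2.map_id']
          congr 1
          funext v
          simp }
  have hind : ∀ g, ∃ ψ : Γ ≃g Γ, ∀ e : Γ.edgeSet, (f.symm (g * f e)).1 = Sym2.map ψ e.1 :=
    fun g => SimpleGraph.exists_iso_of_lineGraph_iso layerGraph_triangleFree
      (layerGraph_exists_two_adj hk (by omega))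
      (f.trans ((SimpleGraph.mulCayleyLeftMul Ω g).trans f.symm))
  have hS : ∀ a b, a ∉ S → b ∉ S → a * b ∈ S := by
    intro a b ha hb
    obtain ⟨ψ, hψ⟩ := hind a
    obtain ⟨χ, hχ⟩ := hind b
    have hne : ∀ (c : G) (θ : Γ ≃g Γ), c ∉ S →
        (∀ e : Γ.edgeSet, (f.symm (c * f e)).1 = Sym2.map θ e.1) →
        ∀ v, (θ v).1.card ≠ v.1.card := fun c θ hc hθ v hv =>
      hc ⟨θ, fun w => (layerGraph_iso_card_iff θ v w).1 hv, hθ⟩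
    refine ⟨χ.trans ψ, fun v => ?_, fun e => ?_⟩
    · have h1 := hne a ψ ha hψ (χ v)
      have h2 := hne b χ hb hχ v
      have h3 := v.2
      have h4 := (χ v).2
      have h5 := (ψ (χ v)).2
      rw [RelIso.trans_apply]
      omega
    · have := hψ (f.symm (b * f e))
      rw [hχ, RelIso.apply_symm_apply, ← mul_assoc, Sym2.map_map] at this
      exact this
  obtain ⟨g, ⟨ψ, hψ, hgψ⟩, hg1, hgg⟩ := S.exists_mul_self_eq_one_of_four_dvd hS (by
    rwa [← Nat.card_congr f.toEquiv])
  obtain ⟨σ, hσ⟩ := layerGraph_exists_perm (by omega) ψ hψ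
  have hσσ : ∀ A : Finset (Fin (2 * k + 1)), A.card = k → (A.image σ).image σ = A := by
    intro A hA
    have hψψ : ψ (ψ ⟨A, Or.inl hA⟩) = ⟨A, Or.inl hA⟩ :=
      SimpleGraph.eq_of_forall_edge_mem (G := Γ) (layerGraph_exists_two_adj hk (by omega))
        fun e he => by
          have h := hgψ (f.symm (g * f e))
          rw [RelIso.apply_symm_apply, ← mul_assoc, hgg, one_mul, RelIso.symm_apply_apply,
            hgψ] at h
          rw [h]
          exact Sym2.mem_map.2 ⟨_, Sym2.mem_map.2 ⟨_, he, rfl⟩, rfl⟩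
    have h := congrArg Subtype.val hψψ
    rwa [hσ, hσ] at h
  have hinv : ∀ x, σ (σ x) = x := by
    intro x
    by_contra hx
    obtain ⟨A, h1, h2, h3⟩ := Finset.exists_subsuperset_card_eq
      (s := {x}) (t := Finset.univ.erase (σ (σ x))) (n := k) (by simpa using Ne.symm hx)
      (by rw [Finset.card_singleton]; exact hk) (by
        rw [Finset.card_erase_of_mem (Finset.mem_univ _), Finset.card_univ, Fintype.card_fin]
        omega)
    have h4 : σ (σ x) ∈ A := hσσ A h3 ▸
      Finset.mem_image_of_mem σ (Finset.mem_image_of_mem σ (h1 (Finset.mem_singleton_self x)))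
    exact Finset.notMem_erase _ _ (h2 h4)
  -- The flag fixed by `σ` is a vertex of the Cayley graph that left translation by `g ≠ 1` fixes.
  obtain ⟨A, x, hA, hx, hσx, hσA⟩ := exists_invariant_flag hke hinv
  have hfix : f.symm (g * f (flagEdge hA hx)) = flagEdge hA hx := by
    refine Subtype.ext ?_
    rw [hgψ]
    change s(ψ _, ψ _) = s(_, _)
    refine congrArg₂ (fun v w => s(v, w)) (Subtype.ext ?_) (Subtype.ext ?_)
    · rw [hσ, hσA]
    · rw [hσ, Finset.image_insert, hσA, hσx]
  have := congrArg f hfix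
  rw [RelIso.apply_symm_apply] at this
  exact hg1 (mul_eq_right.1 this)

theorem theorem3p22 (k : ℕ) (hk : 2 < k) (hke : Even k) (hk2 : ¬ ∃ t : ℕ, k = 2 ^ t) :
    IsVertexTransitive (layerGraph (2 * k + 1) k).lineGraph ∧
      ¬ IsCayleyGraph (layerGraph (2 * k + 1) k).lineGraph := by
  refine ⟨isVertexTransitive_lineGraph_layerGraph _ _,
    not_isCayleyGraph_lineGraph_middleLayer (by omega) hke ?_⟩
  -- The number of edges is `C(2k+1, k) * (k+1) = (2k+1) * C(2k, k)`.
  rw [natCard_edgeSet_layerGraph, show 2 * k + 1 - k = k + 1 by omega,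
    ← Nat.choose_symm_half, ← Nat.add_one_mul_choose_eq, ← Nat.centralBinom_eq_two_mul_choose]
  exact (four_dvd_centralBinom (by omega) hk2).mul_left _
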